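/- There is a universal constant $C>0$ such that the following holds. Let $d\ge 0$ and $K\ge 1$ be integers, let $B>0$, and let $\alpha=(\alpha_1,\dots,\alpha_d)$ be a sorted vector with $B\ge\alpha_1\ge\cdots\ge\alpha_d\ge 0$ and $\sum_{i=1}^d\alpha_i\le 1$. Write $p_k(\alpha)=\sum_{i=1}^d\alpha_i^k$ and $d_{\mathrm{TV}}(x,y)=\frac12\sum_{i=1}^d|x_i-y_i|$. Suppose that real numbers $\widehat p_k, V_k$ $(1\le k\le K)$ satisfy $|\widehat p_k-p_k(\alpha)|\le V_k$ for all $k\in\{1,\dots,K\}$. Consider the following randomized algorithm, whose input is $d,K,B,(\widehat p_k)_{k\le K},(V_k)_{k\le K}$ (but not $\alpha$). 1. (Linear program.) Find a nonnegative measure $\widehat\mu$ on $[0,B]$ with $\widehat\mu([0,B])=d$ and $\bigl|\widehat p_k-\int_0^B x^k\,\widehat\mu(\mathrm dx)\bigr|\le V_k$ for all $k\in\{1,\dots,K\}$. 2. (Randomized rounding.) Let $Q(t)=\inf\{x\in\mathbb R: \widehat\mu((-\infty,x])\ge t\}$ for $0<t\le d$ be the quantile function of $\widehat\mu$ (with $Q(0)=0$).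 Draw $u_1,\dots,u_d$ independently and uniformly from $[0,1]$ and output $\widehat{\alpha}=(\widehat\alpha_1,\dots,\widehat\alpha_d)$ with $\widehat\alpha_i=Q(d-i+u_i)$. Then the linear program is feasible, and for every feasible solution $\widehat\mu$ found in step 1, the output $\widehat\alpha$ is a measurable function of $(u_1,\dots,u_d)$, is always sorted ($\widehat\alpha_1\ge\cdots\ge\widehat\alpha_d$), $d_{\mathrm{TV}}(\widehat\alpha,\alpha)$ is integrable, and $$\mathbb E\, d_{\mathrm{TV}}(\widehat\alpha,\alpha)\le C\Bigl(\frac{\sqrt{Bd}}{K}+2^{9K/2}\,B\sum_{k=1}^K B^{-k}V_k\Bigr).$$ Moreover, the first term can be replaced by $\sqrt{Bd\,(p_1(\alpha)+V_1)}/K$: $$\mathbb E\, d_{\mathrm{TV}}(\widehat\alpha,\alpha)\le C\Bigl(\frac{\sqrt{Bd\,(p_1(\alpha)+V_1)}}{K}+2^{9K/2}\,B\sum_{k=1}^K B^{-k}V_k\Bigr).$$ -/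

import Mathlib

open MeasureTheory

namespace LocalMomentMatching

/-- Total variation distance between two vectors of the same length. -/
noncomputable def dTV {d : ℕ} (x y : Fin d → ℝ) : ℝ :=
  (1 / 2) * ∑ i, |x i - y i|

/-- The power sum `p_k(x) = ∑ i, x_i ^ k`. -/
def powerSum {d : ℕ} (k : ℕ) (x : Fin d → ℝ) : ℝ :=
  ∑ i, x i ^ k

/-- `μ` is a feasible solution of the (semi-infinite) linear program with data `d, B, K, p, V`:
a nonnegative measure on `[0, B]` of total mass `d` whose `k`-th moment is within `V k` of `p k`
for every `k` in `{1, ..., K}`. Only the entries `p k` and `V k` with `1 ≤ k ≤ K` are read. -/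
structure IsLPSolution (d : ℕ) (B : ℝ) (K : ℕ) (p V : ℕ → ℝ) (μ : Measure ℝ) : Prop where
  supported : μ (Set.Icc 0 B)ᶜ = 0
  mass : μ (Set.Icc 0 B) = d
  moments : ∀ k ∈ Finset.Icc 1 K, |p k - ∫ x in Set.Icc 0 B, x ^ k ∂μ| ≤ V k

/-- The quantile function of a finite measure on the line (not normalized):
the least `x` with `μ (-∞, x] ≥ t`, for `0 < t ≤ μ ℝ`. -/
noncomputable def quantile (μ : Measure ℝ) (t : ℝ) : ℝ :=
  sInf {x : ℝ | t ≤ μ.real (Set.Iic x)}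

/-- Randomized rounding of a measure `μ` of total mass `d` to a vector of length `d`.
Cut `μ`, from the right to the left, into `d` consecutive pieces of mass one; the `i`-th output
coordinate is drawn from the `i`-th piece. The random seed `u` consists of `d` independent uniform
samples from `[0, 1]`, i.e. its law is `volume` on `Fin d → unitInterval`; since indices start at
`0`, the `i`-th piece carries the quantile levels from `d - 1 - i` to `d - i`. -/
noncomputable def round (d : ℕ) (μ : Measure ℝ) (u : Fin d → unitInterval) : Fin d → ℝ :=
  fun i => quantile μ ((d : ℝ) - 1 - (i : ℝ) + (u i : ℝ))

end LocalMomentMatching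

open MeasureTheory

namespace LocalMomentMatching

/-! Let ν be the counting measure of the entries of α. The i-th output samples μ at a uniform
quantile level between d-1-i and d-i, and on these levels (up to an endpoint) the quantile function
of ν equals α_i. Rounding thus realises the monotone coupling of μ and ν, and the expected error is
half their (unnormalised) Wasserstein-1 distance. `exists_integral_dTV_eq` writes it as (∫ f dμ - ∫
f dν)/2 for a single 1-Lipschitz f with f(0) = 0, whose slope is the sign of the difference of the
two distribution functions.

On [0, B], `exists_coeff_approx` replaces f by a polynomial ∑ c_k x^k without constant term, with
error O(√(Bx)/K) and |c_k| ≤ 16^K B^(1-k). Both μ and ν are feasible, so their k-th moments differ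
by at most 2 V_k; this yields the second term of the bound. The approximation error yields the first
term through ∫ √x ≤ √(d ∫ x), and its factor √x is what brings in p_1 + V_1.

For the approximation (`exists_polynomial_approx`, on [0, 1]), put x = (1 - cos θ)/2, convolve with
a Fejér-Korovkin kernel and subtract the value at θ = 0. The error is then a kernel average over t
of second differences of size O(|sin(θ/2)| |sin(t/2)|): the first factor is √x, and the second has
mean O(1/K). -/

/-! ### Coefficients of shifted Chebyshev polynomials -/

open Polynomial in
/-- The coefficients of `T_m(1 - 2x)` are at most `7 ^ m` in absolute value. -/
theorem abs_coeff_chebyshev_comp_le (m : ℕ) (k : ℕ) :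
    |((Chebyshev.T ℝ m).comp (1 - 2 * X)).coeff k| ≤ 7 ^ m := by
  have key : ∀ n : ℕ, (∀ k, |((Chebyshev.T ℝ n).comp (1 - 2 * X)).coeff k| ≤ 7 ^ n) ∧
      ∀ k, |((Chebyshev.T ℝ (n + 1 : ℕ)).comp (1 - 2 * X)).coeff k| ≤ 7 ^ (n + 1) := by
    intro n
    induction n with
    | zero =>
      constructor
      · intro k
        simp only [Nat.cast_zero, Chebyshev.T_zero, one_comp, coeff_one]
        split_ifs <;> simp
      · intro k
        have h2 : (2 * X : ℝ[X]) = C 2 * X := rfl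
        simp only [zero_add, Nat.cast_one, Chebyshev.T_one, X_comp, coeff_sub, coeff_one, h2,
          coeff_C_mul, coeff_X]
        split_ifs <;> norm_num
    | succ n ih =>
      refine ⟨ih.2, fun k => ?_⟩
      have hrec : (Chebyshev.T ℝ (n + 1 + 1 : ℕ)).comp (1 - 2 * X) =
          C 2 * (Chebyshev.T ℝ (n + 1 : ℕ)).comp (1 - 2 * X)
            - C 4 * ((Chebyshev.T ℝ (n + 1 : ℕ)).comp (1 - 2 * X) * X)
            - (Chebyshev.T ℝ n).comp (1 - 2 * X) := by
        have h := Chebyshev.T_add_two ℝ (n : ℤ)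
        have e2 : ((n + 1 + 1 : ℕ) : ℤ) = (n : ℤ) + 2 := by push_cast; ring
        have e1 : ((n + 1 : ℕ) : ℤ) = (n : ℤ) + 1 := by push_cast; ring
        rw [e2, e1, h]
        simp only [sub_comp, mul_comp, X_comp, ofNat_comp]
        have h2 : (C 2 : ℝ[X]) = 2 := rfl
        have h4 : (C 4 : ℝ[X]) = 4 := rfl
        rw [h2, h4]
        ring
      have hmul : |(((Chebyshev.T ℝ (n + 1 : ℕ)).comp (1 - 2 * X) : ℝ[X]) * X).coeff k|
          ≤ 7 ^ (n + 1) := by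
        cases k with
        | zero => simp
        | succ k => rw [coeff_mul_X]; exact ih.2 k
      rw [hrec]
      simp only [coeff_sub, coeff_C_mul]
      have h1 := ih.1 k
      have h2 := ih.2 k
      -- The recurrence gives 2·7 + 4·7 + 1 = 43 times 7^n, below 49 · 7^n.
      have h7 : (7 : ℝ) ^ (n + 1 + 1) = 49 * 7 ^ n := by ring
      have h7' : (7 : ℝ) ^ (n + 1) = 7 * 7 ^ n := by ring
      have h7n : (0 : ℝ) < 7 ^ n := by positivity
      rw [h7]
      rw [h7', abs_le] at h2 hmul
      rw [abs_le] at h1 ⊢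
      constructor <;> linarith [h1.1, h1.2, h2.1, h2.2, hmul.1, hmul.2]
  exact (key m).1 k

/-! ### The Fejér-Korovkin kernel: positivity, mass and first cosine moment -/

/-- The weights of the Fejér-Korovkin kernel. -/
noncomputable def kernelWeight (N : ℕ) (j : ℤ) : ℝ := Real.sin (j * Real.pi / N)

/-- The (non-normalized) Fejér-Korovkin kernel `|∑ j < N, sin (jπ/N) e^{ijt}| ^ 2`. -/
noncomputable def jacksonKernel (N : ℕ) (t : ℝ) : ℝ :=
  ∑ j ∈ Finset.range N, ∑ k ∈ Finset.range N,
    kernelWeight N j * kernelWeight N k * Real.cos (((j - k : ℤ) : ℝ) * t)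

/-- The mean value of the kernel `jacksonKernel`. -/
noncomputable def kernelMass (N : ℕ) : ℝ := ∑ j ∈ Finset.range N, kernelWeight N j ^ 2

theorem jacksonKernel_nonneg (N : ℕ) (t : ℝ) : 0 ≤ jacksonKernel N t := by
  have h : jacksonKernel N t =
      (∑ j ∈ Finset.range N, kernelWeight N j * Real.cos (j * t)) ^ 2 +
        (∑ j ∈ Finset.range N, kernelWeight N j * Real.sin (j * t)) ^ 2 := by
    rw [sq, sq, Finset.sum_mul_sum, Finset.sum_mul_sum, ← Finset.sum_add_distrib, jacksonKernel]
    refine Finset.sum_congr rfl fun j _ => ?_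
    rw [← Finset.sum_add_distrib]
    refine Finset.sum_congr rfl fun k _ => ?_
    push_cast
    rw [sub_mul, Real.cos_sub]
    ring
  rw [h]
  positivity

theorem continuous_jacksonKernel (N : ℕ) : Continuous (jacksonKernel N) := by
  unfold jacksonKernel
  fun_prop

theorem kernelMass_pos {N : ℕ} (hN : 2 ≤ N) : 0 < kernelMass N := by
  have h1 : 0 < kernelWeight N 1 := by
    unfold kernelWeight
    have : (2 : ℝ) ≤ N := by exact_mod_cast hN
    apply Real.sin_pos_of_pos_of_lt_pi
    · have := Real.pi_pos
      push_cast
      positivity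
    · rw [div_lt_iff₀ (by linarith)]
      push_cast
      nlinarith [Real.pi_pos]
  unfold kernelMass
  refine Finset.sum_pos' (fun _ _ => sq_nonneg _) ⟨1, Finset.mem_range.2 (by omega), ?_⟩
  exact_mod_cast pow_pos h1 2

theorem integral_cos_int_mul (m : ℤ) :
    ∫ t in (-Real.pi)..Real.pi, Real.cos ((m : ℝ) * t) = if m = 0 then 2 * Real.pi else 0 := by
  split_ifs with h
  · subst h
    simp
    ring
  · have hm : (m : ℝ) ≠ 0 := by exact_mod_cast h
    rw [intervalIntegral.integral_comp_mul_left (fun x => Real.cos x) hm, integral_cos]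
    simp [Real.sin_int_mul_pi]

theorem integral_jacksonKernel (N : ℕ) :
    ∫ t in (-Real.pi)..Real.pi, jacksonKernel N t = 2 * Real.pi * kernelMass N := by
  unfold jacksonKernel
  rw [intervalIntegral.integral_finsetSum
    (fun j _ => (by fun_prop : Continuous _).intervalIntegrable _ _), kernelMass, Finset.mul_sum]
  refine Finset.sum_congr rfl fun j hj => ?_
  rw [intervalIntegral.integral_finsetSum
    (fun j _ => (by fun_prop : Continuous _).intervalIntegrable _ _)]
  simp only [intervalIntegral.integral_const_mul, integral_cos_int_mul, sub_eq_zero, Nat.cast_inj]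
  rw [Finset.sum_eq_single_of_mem j hj (fun k _ hk => by simp [hk.symm])]
  simp
  ring

theorem kernelWeight_zero (N : ℕ) : kernelWeight N 0 = 0 := by simp [kernelWeight]

theorem kernelWeight_self {N : ℕ} (hN : 2 ≤ N) : kernelWeight N N = 0 := by
  have : (N : ℝ) ≠ 0 := by positivity
  simp [kernelWeight, this]

/-- The reason for sine weights: they form the top eigenvector of the path 1, ..., N-1, which makes
the kernel mean of cos t equal to cos(π/N), hence 1 - O(1/N²). -/
theorem kernelWeight_add_kernelWeight (N : ℕ) (j : ℤ) :
    kernelWeight N (j + 1) + kernelWeight N (j - 1) =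
      2 * Real.cos (Real.pi / N) * kernelWeight N j := by
  unfold kernelWeight
  push_cast
  have e1 : ((j : ℝ) + 1) * Real.pi / N = j * Real.pi / N + Real.pi / N := by ring
  have e2 : ((j : ℝ) - 1) * Real.pi / N = j * Real.pi / N - Real.pi / N := by ring
  rw [e1, e2, Real.sin_add, Real.sin_sub]
  ring

theorem integral_jacksonKernel_mul_cos {N : ℕ} (hN : 2 ≤ N) :
    ∫ t in (-Real.pi)..Real.pi, jacksonKernel N t * Real.cos t =
      2 * Real.pi * kernelMass N * Real.cos (Real.pi / N) := by
  have hcos : ∀ t : ℝ, ∀ m : ℤ, Real.cos ((m : ℝ) * t) * Real.cos t =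
      1 / 2 * Real.cos (((m + 1 : ℤ) : ℝ) * t) + 1 / 2 * Real.cos (((m - 1 : ℤ) : ℝ) * t) := by
    intro t m
    push_cast
    rw [add_mul, sub_mul, one_mul, Real.cos_add, Real.cos_sub]
    ring
  have hint : ∀ j k : ℕ, ∫ t in (-Real.pi)..Real.pi,
      kernelWeight N j * kernelWeight N k * Real.cos (((j - k : ℤ) : ℝ) * t) * Real.cos t =
      Real.pi * (kernelWeight N j * ((if k = j + 1 then kernelWeight N k else 0) +
        (if j = k + 1 then kernelWeight N k else 0))) := by
    intro j k
    simp only [mul_assoc, hcos]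
    rw [intervalIntegral.integral_const_mul, intervalIntegral.integral_const_mul,
      intervalIntegral.integral_add ((by fun_prop : Continuous _).intervalIntegrable _ _)
        ((by fun_prop : Continuous _).intervalIntegrable _ _),
      intervalIntegral.integral_const_mul, intervalIntegral.integral_const_mul,
      integral_cos_int_mul, integral_cos_int_mul]
    have e1 : ((j : ℤ) - k + 1 = 0) ↔ k = j + 1 := by omega
    have e2 : ((j : ℤ) - k - 1 = 0) ↔ j = k + 1 := by omega
    simp only [e1, e2]
    split_ifs <;> ring
  unfold jacksonKernel
  simp only [Finset.sum_mul]
  rw [intervalIntegral.integral_finsetSum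
    (fun j _ => (by fun_prop : Continuous _).intervalIntegrable _ _), kernelMass, Finset.mul_sum,
    Finset.sum_mul]
  refine Finset.sum_congr rfl fun j hj => ?_
  rw [intervalIntegral.integral_finsetSum
    (fun j _ => (by fun_prop : Continuous _).intervalIntegrable _ _)]
  simp only [hint]
  rw [← Finset.mul_sum, ← Finset.mul_sum, Finset.sum_add_distrib]
  have hj' := Finset.mem_range.1 hj
  -- Neighbours outside `range N` cost nothing, because the weights vanish at 0 and at N.
  have s1 : ∑ k ∈ Finset.range N, (if k = j + 1 then kernelWeight N k else 0) =
      kernelWeight N (j + 1) := by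
    rw [Finset.sum_ite_eq' (Finset.range N) (j + 1) (fun k : ℕ => kernelWeight N k)]
    split_ifs with h
    · push_cast; rfl
    · have : j + 1 = N := by simp at h; omega
      have : (j : ℤ) + 1 = N := by omega
      rw [this, kernelWeight_self hN]
  have s2 : kernelWeight N j * ∑ k ∈ Finset.range N, (if j = k + 1 then kernelWeight N k else 0) =
      kernelWeight N j * kernelWeight N (j - 1) := by
    cases j with
    | zero => simp [kernelWeight_zero]
    | succ j =>
      congr 1
      simp only [add_left_inj]
      rw [Finset.sum_ite_eq (Finset.range N) j (fun k : ℕ => kernelWeight N k),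
        if_pos (Finset.mem_range.2 (by omega))]
      simp
  rw [mul_add, s2, s1, ← mul_add, kernelWeight_add_kernelWeight]
  ring

/-! ### Lipschitz functions in the angular variable and their convolution with the kernel -/

/-- The even `2π`-periodic function `θ ↦ f ((1 - cos θ) / 2)` corresponding to `f` on `[0, 1]`. -/
noncomputable def cosLift (f : ℝ → ℝ) (θ : ℝ) : ℝ := f ((1 - Real.cos θ) / 2)

section cosLift

variable {f : ℝ → ℝ}

theorem abs_cosLift_sub_le (hf : LipschitzWith 1 f) (a b : ℝ) :
    |cosLift f a - cosLift f b| ≤ |Real.sin ((a + b) / 2)| * |Real.sin ((a - b) / 2)| := by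
  have h := hf.dist_le_mul ((1 - Real.cos a) / 2) ((1 - Real.cos b) / 2)
  rw [Real.dist_eq, Real.dist_eq, NNReal.coe_one, one_mul] at h
  refine h.trans (le_of_eq ?_)
  have : (1 - Real.cos a) / 2 - (1 - Real.cos b) / 2 =
      Real.sin ((a + b) / 2) * Real.sin ((a - b) / 2) := by
    linear_combination (-1 / 2) * Real.cos_sub_cos a b
  rw [this, abs_mul]

theorem cosLift_neg (f : ℝ → ℝ) (θ : ℝ) : cosLift f (-θ) = cosLift f θ := by simp [cosLift]

theorem cosLift_periodic (f : ℝ → ℝ) : Function.Periodic (cosLift f) (2 * Real.pi) := by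
  intro θ
  simp [cosLift]

theorem continuous_cosLift (hf : LipschitzWith 1 f) : Continuous (cosLift f) := by
  have := hf.continuous
  unfold cosLift
  fun_prop

theorem abs_cosLift_le_one (hf : LipschitzWith 1 f) (h0 : f 0 = 0) (θ : ℝ) :
    |cosLift f θ| ≤ 1 := by
  have h := abs_cosLift_sub_le hf θ 0
  simp only [cosLift, Real.cos_zero, sub_self, zero_div, h0, sub_zero, add_zero] at h
  refine h.trans ?_
  nlinarith [Real.abs_sin_le_one (θ / 2), abs_nonneg (Real.sin (θ / 2))]

theorem abs_sin_add_le (a b : ℝ) :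
    |Real.sin (2 * a + b)| ≤ 2 * |Real.sin a| + |Real.sin b| := by
  rw [Real.sin_add, Real.sin_two_mul]
  refine (abs_add_le _ _).trans (add_le_add ?_ ?_)
  · rw [abs_mul, abs_mul, abs_mul, abs_two]
    have h1 := mul_le_mul (Real.abs_cos_le_one a) (Real.abs_cos_le_one b) (abs_nonneg _) zero_le_one
    nlinarith [abs_nonneg (Real.sin a)]
  · rw [abs_mul]
    nlinarith [Real.abs_cos_le_one (2 * a), abs_nonneg (Real.sin b)]

/-- The second difference is symmetric in θ and t. Pairing its terms as increments of length b gives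
2|sin(a/2)||sin(b/2)| + 2 sin²(b/2); taking for b the variable with the smaller sine absorbs the
square into the product. -/
theorem abs_cosLift_secondDiff_le (hf : LipschitzWith 1 f) (θ t : ℝ) :
    |cosLift f (t + θ) - cosLift f t - (cosLift f θ - cosLift f 0)| ≤
      4 * |Real.sin (θ / 2)| * |Real.sin (t / 2)| := by
  have main : ∀ a b : ℝ, |cosLift f (a + b) - cosLift f a - (cosLift f b - cosLift f 0)| ≤
      2 * |Real.sin (a / 2)| * |Real.sin (b / 2)| + 2 * |Real.sin (b / 2)| ^ 2 := by
    intro a b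
    have h1 := abs_cosLift_sub_le hf (a + b) a
    have h2 := abs_cosLift_sub_le hf b 0
    have e1 : (a + b + a) / 2 = 2 * (a / 2) + b / 2 := by ring
    have e2 : (a + b - a) / 2 = b / 2 := by ring
    rw [e1, e2] at h1
    rw [add_zero, sub_zero] at h2
    have h3 := mul_le_mul_of_nonneg_right (abs_sin_add_le (a / 2) (b / 2))
      (abs_nonneg (Real.sin (b / 2)))
    refine (abs_sub _ _).trans ?_
    nlinarith
  have h1 := main t θ
  have h2 := main θ t
  have e : cosLift f (t + θ) - cosLift f t - (cosLift f θ - cosLift f 0) =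
      cosLift f (θ + t) - cosLift f θ - (cosLift f t - cosLift f 0) := by
    rw [add_comm]; ring
  rcases le_total |Real.sin (θ / 2)| |Real.sin (t / 2)| with h | h
  · nlinarith [abs_nonneg (Real.sin (θ / 2))]
  · rw [e]
    nlinarith [abs_nonneg (Real.sin (t / 2))]

theorem integral_cosLift_mul_sin (f : ℝ → ℝ) (m : ℝ) :
    ∫ s in (-Real.pi)..Real.pi, cosLift f s * Real.sin (m * s) = 0 := by
  have h := intervalIntegral.integral_comp_neg (a := -Real.pi) (b := Real.pi)
    (fun s => cosLift f s * Real.sin (m * s))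
  simp only [cosLift_neg, mul_neg, Real.sin_neg, intervalIntegral.integral_neg, neg_neg] at h
  linarith

/-- The Fourier cosine coefficients of `cosLift f`, up to normalization. -/
noncomputable def cosCoeff (f : ℝ → ℝ) (m : ℤ) : ℝ :=
  ∫ s in (-Real.pi)..Real.pi, cosLift f s * Real.cos (m * s)

theorem abs_cosCoeff_le (hf : LipschitzWith 1 f) (h0 : f 0 = 0) (m : ℤ) :
    |cosCoeff f m| ≤ 2 * Real.pi := by
  have h := intervalIntegral.norm_integral_le_of_norm_le_const (a := -Real.pi) (b := Real.pi)
    (f := fun s => cosLift f s * Real.cos (m * s)) (C := 1) (fun s _ => by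
      rw [Real.norm_eq_abs, abs_mul]
      exact mul_le_one₀ (abs_cosLift_le_one hf h0 s) (abs_nonneg _) (Real.abs_cos_le_one _))
  rw [Real.norm_eq_abs, one_mul, sub_neg_eq_add, abs_of_pos (add_pos Real.pi_pos Real.pi_pos)] at h
  unfold cosCoeff
  linarith

theorem integral_cosLift_mul_cos_sub (hf : LipschitzWith 1 f) (m : ℤ) (θ : ℝ) :
    ∫ s in (-Real.pi)..Real.pi, cosLift f s * Real.cos (m * (s - θ)) =
      cosCoeff f m * Real.cos (m * θ) := by
  have hc := continuous_cosLift hf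
  have : ∀ s, cosLift f s * Real.cos (m * (s - θ)) =
      cosLift f s * Real.cos (m * s) * Real.cos (m * θ) +
        cosLift f s * Real.sin (m * s) * Real.sin (m * θ) := by
    intro s
    rw [mul_sub, Real.cos_sub]
    ring
  simp only [this]
  rw [intervalIntegral.integral_add ((by fun_prop : Continuous _).intervalIntegrable _ _)
    ((by fun_prop : Continuous _).intervalIntegrable _ _), intervalIntegral.integral_mul_const,
    intervalIntegral.integral_mul_const, integral_cosLift_mul_sin, zero_mul, add_zero, cosCoeff]

theorem jacksonKernel_periodic (N : ℕ) : Function.Periodic (jacksonKernel N) (2 * Real.pi) := by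
  intro t
  unfold jacksonKernel
  refine Finset.sum_congr rfl fun j _ => Finset.sum_congr rfl fun k _ => ?_
  rw [mul_add, Real.cos_add_int_mul_two_pi]

/-- Periodicity moves the shift by θ onto the kernel, and evenness of `cosLift f` kills the sine
parts. The result is a cosine polynomial in θ, that is, a polynomial in cos θ. -/
theorem integral_jacksonKernel_mul_cosLift (hf : LipschitzWith 1 f) (N : ℕ) (θ : ℝ) :
    ∫ t in (-Real.pi)..Real.pi, jacksonKernel N t * cosLift f (t + θ) =
      ∑ j ∈ Finset.range N, ∑ k ∈ Finset.range N, kernelWeight N j * kernelWeight N k *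
        (cosCoeff f (j - k) * Real.cos (((j - k : ℤ) : ℝ) * θ)) := by
  have hc := continuous_cosLift hf
  have hJ := continuous_jacksonKernel N
  have hper : Function.Periodic (fun s => jacksonKernel N (s - θ) * cosLift f s)
      (2 * Real.pi) := by
    intro s
    simp only
    rw [cosLift_periodic f s, add_sub_right_comm, jacksonKernel_periodic N]
  have h1 : ∫ t in (-Real.pi)..Real.pi, jacksonKernel N t * cosLift f (t + θ) =
      ∫ s in (-Real.pi)..Real.pi, jacksonKernel N (s - θ) * cosLift f s := by
    have h := intervalIntegral.integral_comp_add_right (a := -Real.pi) (b := Real.pi)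
      (fun s => jacksonKernel N (s - θ) * cosLift f s) θ
    simp only [add_sub_cancel_right] at h
    rw [h]
    have h' := hper.intervalIntegral_add_eq (-Real.pi + θ) (-Real.pi)
    have e1 : -Real.pi + θ + 2 * Real.pi = Real.pi + θ := by ring
    have e2 : -Real.pi + 2 * Real.pi = Real.pi := by ring
    rwa [e1, e2] at h'
  rw [h1]
  unfold jacksonKernel
  simp only [Finset.sum_mul]
  rw [intervalIntegral.integral_finsetSum
    (fun j _ => (by fun_prop : Continuous _).intervalIntegrable _ _)]
  refine Finset.sum_congr rfl fun j _ => ?_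
  rw [intervalIntegral.integral_finsetSum
    (fun j _ => (by fun_prop : Continuous _).intervalIntegrable _ _)]
  refine Finset.sum_congr rfl fun k _ => ?_
  rw [← integral_cosLift_mul_cos_sub hf, ← intervalIntegral.integral_const_mul]
  refine intervalIntegral.integral_congr fun s _ => ?_
  ring

/-- The kernel mean of sin²(t/2) is (1 - cos(π/N))/2 = ε² with ε = sin(π/(2N)). The inequality |s| ≤
ε/2 + s²/(2ε) then bounds the mean of |sin(t/2)| by ε. -/
theorem integral_jacksonKernel_mul_abs_sin_le {N : ℕ} (hN : 2 ≤ N) :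
    ∫ t in (-Real.pi)..Real.pi, jacksonKernel N t * |Real.sin (t / 2)| ≤
      2 * Real.pi * kernelMass N * (Real.pi / (2 * N)) := by
  have hJ := continuous_jacksonKernel N
  have hpi := Real.pi_pos
  have hN' : (2 : ℝ) ≤ N := by exact_mod_cast hN
  set ε := Real.sin (Real.pi / (2 * N)) with hε
  have hεpos : 0 < ε := by
    apply Real.sin_pos_of_pos_of_lt_pi (by positivity)
    rw [div_lt_iff₀ (by positivity)]
    nlinarith
  have hεle : ε ≤ Real.pi / (2 * N) := Real.sin_le (by positivity)
  have hbound : ∀ t ∈ Set.Icc (-Real.pi) Real.pi, jacksonKernel N t * |Real.sin (t / 2)| ≤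
      (ε / 2 + 1 / (4 * ε)) * jacksonKernel N t
        - 1 / (4 * ε) * (jacksonKernel N t * Real.cos t) := by
    intro t _
    have h1 : Real.sin (t / 2) ^ 2 = 1 / 2 - Real.cos t / 2 := by
      rw [Real.sin_sq_eq_half_sub]
      congr 3
      ring
    have h2 : |Real.sin (t / 2)| ≤ ε / 2 + 1 / (2 * ε) * Real.sin (t / 2) ^ 2 := by
      rw [← sq_abs (Real.sin (t / 2))]
      have : ε / 2 + 1 / (2 * ε) * |Real.sin (t / 2)| ^ 2 - |Real.sin (t / 2)| =
          1 / (2 * ε) * (|Real.sin (t / 2)| - ε) ^ 2 := by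
        field_simp
        ring
      have h3 : 0 ≤ 1 / (2 * ε) * (|Real.sin (t / 2)| - ε) ^ 2 := by positivity
      linarith
    rw [h1] at h2
    refine (mul_le_mul_of_nonneg_left h2 (jacksonKernel_nonneg N t)).trans (le_of_eq ?_)
    field_simp
    ring
  refine (intervalIntegral.integral_mono_on (by linarith)
    ((by fun_prop : Continuous _).intervalIntegrable _ _)
    ((by fun_prop : Continuous _).intervalIntegrable _ _) hbound).trans ?_
  rw [intervalIntegral.integral_sub ((by fun_prop : Continuous _).intervalIntegrable _ _)
    ((by fun_prop : Continuous _).intervalIntegrable _ _), intervalIntegral.integral_const_mul,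
    intervalIntegral.integral_const_mul, integral_jacksonKernel, integral_jacksonKernel_mul_cos hN]
  have hcos : Real.cos (Real.pi / N) = 1 - 2 * ε ^ 2 := by
    have h := Real.cos_sq' (Real.pi / (2 * N))
    have h' := Real.cos_two_mul (Real.pi / (2 * N))
    have e : 2 * (Real.pi / (2 * N)) = Real.pi / N := by field_simp
    rw [e] at h'
    rw [h', h]
    ring
  rw [hcos]
  have hS := kernelMass_pos hN
  have : (ε / 2 + 1 / (4 * ε)) * (2 * Real.pi * kernelMass N) -
      1 / (4 * ε) * (2 * Real.pi * kernelMass N * (1 - 2 * ε ^ 2)) =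
      2 * Real.pi * kernelMass N * ε := by
    field_simp
    ring
  rw [this]
  exact mul_le_mul_of_nonneg_left hεle (by positivity)

end cosLift

/-! ### Pointwise polynomial approximation with coefficient control -/

open Polynomial in
/-- A pointwise Jackson theorem: a `1`-Lipschitz function on `[0, 1]` that vanishes at `0` is
within `O(√x / K)` of a polynomial of degree at most `K` that vanishes at `0` and whose
coefficients are at most exponentially large in `K`. -/
theorem exists_polynomial_approx {f : ℝ → ℝ} (hf : LipschitzWith 1 f) (h0 : f 0 = 0) {K : ℕ}
    (hK : 1 ≤ K) :
    ∃ P : ℝ[X], P.natDegree ≤ K ∧ P.coeff 0 = 0 ∧ (∀ k, |P.coeff k| ≤ 16 ^ K) ∧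
      ∀ x ∈ Set.Icc (0 : ℝ) 1, |f x - P.eval x| ≤ 7 * √x / K := by
  -- The kernel has frequencies |j - k| ≤ N - 1 = K.
  set N := K + 1 with hN
  have hN2 : 2 ≤ N := by omega
  have hS := kernelMass_pos hN2
  have hpi := Real.pi_pos
  have hK0 : (0 : ℝ) < K := by exact_mod_cast hK
  set M := 2 * Real.pi * kernelMass N with hM
  have hMpos : 0 < M := by positivity
  -- The normalised convolution in the variable x, where cos(mθ) = T_m(1 - 2x).
  set Q : ℝ[X] := ∑ j ∈ Finset.range N, ∑ k ∈ Finset.range N,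
    C (kernelWeight N j * kernelWeight N k * cosCoeff f (j - k) / M) *
      (Chebyshev.T ℝ (j - k : ℤ)).comp (1 - 2 * X) with hQ
  have hlin : (1 - 2 * X : ℝ[X]).natDegree ≤ 1 := by
    have : (1 - 2 * X : ℝ[X]) = C (-2) * X + C 1 := by
      simp only [C_neg, map_one, show (C 2 : ℝ[X]) = 2 from rfl]
      ring
    rw [this]
    exact natDegree_linear_le
  have hnat : ∀ j ∈ Finset.range N, ∀ k ∈ Finset.range N, ((j : ℤ) - k).natAbs ≤ K := by
    intro j hj k hk
    rw [Finset.mem_range] at hj hk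
    omega
  have hQdeg : Q.natDegree ≤ K := by
    refine natDegree_sum_le_of_forall_le _ _ fun j hj => natDegree_sum_le_of_forall_le _ _
      fun k hk => (natDegree_C_mul_le _ _).trans (natDegree_comp_le.trans ?_)
    rw [Chebyshev.natDegree_T]
    exact (Nat.mul_le_mul (hnat j hj k hk) hlin).trans (by omega)
  have hQcoeff : ∀ i, |Q.coeff i| ≤ 16 ^ K := by
    intro i
    have hterm : ∀ j ∈ Finset.range N, ∀ k ∈ Finset.range N,
        |(C (kernelWeight N j * kernelWeight N k * cosCoeff f (j - k) / M) *
          (Chebyshev.T ℝ (j - k : ℤ)).comp (1 - 2 * X)).coeff i| ≤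
        |kernelWeight N j| * |kernelWeight N k| * (7 ^ K / kernelMass N) := by
      intro j hj k hk
      have h7 : |((Chebyshev.T ℝ (j - k : ℤ)).comp (1 - 2 * X)).coeff i| ≤ (7 : ℝ) ^ K := by
        rw [← Chebyshev.T_natAbs]
        exact (abs_coeff_chebyshev_comp_le _ i).trans
          (pow_le_pow_right₀ (by norm_num) (hnat j hj k hk))
      have hc := abs_cosCoeff_le hf h0 (j - k)
      rw [coeff_C_mul, abs_mul, abs_div, abs_mul, abs_mul, abs_of_pos hMpos, mul_div_assoc,
        mul_assoc]
      refine mul_le_mul_of_nonneg_left ?_ (by positivity)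
      calc |cosCoeff f (j - k)| / M * |((Chebyshev.T ℝ (j - k : ℤ)).comp (1 - 2 * X)).coeff i|
          ≤ 2 * Real.pi / M * 7 ^ K := by gcongr
        _ = 7 ^ K / kernelMass N := by rw [hM]; field_simp
    have hsum : |Q.coeff i| ≤ (∑ j ∈ Finset.range N, |kernelWeight N j|) ^ 2 *
        (7 ^ K / kernelMass N) := by
      rw [hQ, finsetSum_coeff, sq, Finset.sum_mul_sum, Finset.sum_mul]
      refine (Finset.abs_sum_le_sum_abs _ _).trans (Finset.sum_le_sum fun j hj => ?_)
      rw [finsetSum_coeff, Finset.sum_mul]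
      exact (Finset.abs_sum_le_sum_abs _ _).trans (Finset.sum_le_sum fun k hk => hterm j hj k hk)
    -- Cauchy-Schwarz cancels the normalisation by `kernelMass`, so no lower bound on the mass is
    -- needed.
    have hcs : (∑ j ∈ Finset.range N, |kernelWeight N j|) ^ 2 ≤ N * kernelMass N := by
      have h := sq_sum_le_card_mul_sum_sq (s := Finset.range N)
        (f := fun j : ℕ => |kernelWeight N j|)
      simpa only [sq_abs, Finset.card_range, kernelMass] using h
    have h2 : (N : ℝ) ≤ 2 ^ K := by
      exact_mod_cast (Nat.lt_two_pow_self : K < 2 ^ K)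
    calc |Q.coeff i| ≤ (N * kernelMass N) * (7 ^ K / kernelMass N) :=
          hsum.trans (mul_le_mul_of_nonneg_right hcs (by positivity))
      _ = N * 7 ^ K := by field_simp
      _ ≤ 2 ^ K * 7 ^ K := by gcongr
      _ = 14 ^ K := by rw [← mul_pow]; norm_num
      _ ≤ 16 ^ K := by gcongr; norm_num
  have hQeval : ∀ θ : ℝ, Q.eval ((1 - Real.cos θ) / 2) =
      (∫ t in (-Real.pi)..Real.pi, jacksonKernel N t * cosLift f (t + θ)) / M := by
    intro θ
    rw [integral_jacksonKernel_mul_cosLift hf, hQ, eval_finsetSum, Finset.sum_div]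
    refine Finset.sum_congr rfl fun j _ => ?_
    rw [eval_finsetSum, Finset.sum_div]
    refine Finset.sum_congr rfl fun k _ => ?_
    have e : (1 - 2 * X : ℝ[X]).eval ((1 - Real.cos θ) / 2) = Real.cos θ := by
      simp only [eval_sub, eval_one, eval_mul, eval_ofNat, eval_X]
      ring
    rw [eval_mul, eval_C, eval_comp, e, Chebyshev.T_real_cos]
    ring
  have herr : ∀ θ : ℝ, |cosLift f θ - (Q.eval ((1 - Real.cos θ) / 2) - Q.eval 0)| ≤
      7 * |Real.sin (θ / 2)| / K := by
    intro θ
    have hc := continuous_cosLift hf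
    have hJ := continuous_jacksonKernel N
    have hcl0 : cosLift f 0 = 0 := by simp [cosLift, h0]
    have hQ0 : Q.eval 0 = (∫ t in (-Real.pi)..Real.pi, jacksonKernel N t * cosLift f t) / M := by
      simpa using hQeval 0
    -- Subtracting the value at 0 turns the convolution error into an average of second differences.
    have hdiff : M * (Q.eval ((1 - Real.cos θ) / 2) - Q.eval 0 - cosLift f θ) =
        ∫ t in (-Real.pi)..Real.pi, jacksonKernel N t *
          (cosLift f (t + θ) - cosLift f t - (cosLift f θ - cosLift f 0)) := by
      simp only [hcl0, mul_sub, sub_zero]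
      rw [intervalIntegral.integral_sub ((by fun_prop : Continuous _).intervalIntegrable _ _)
        ((by fun_prop : Continuous _).intervalIntegrable _ _),
        intervalIntegral.integral_sub ((by fun_prop : Continuous _).intervalIntegrable _ _)
        ((by fun_prop : Continuous _).intervalIntegrable _ _),
        intervalIntegral.integral_mul_const, integral_jacksonKernel, hQeval, hQ0,
        mul_div_cancel₀ _ hMpos.ne', mul_div_cancel₀ _ hMpos.ne']
    have hle : |M * (Q.eval ((1 - Real.cos θ) / 2) - Q.eval 0 - cosLift f θ)| ≤
        4 * |Real.sin (θ / 2)| * (M * (Real.pi / (2 * N))) := by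
      rw [hdiff]
      refine (intervalIntegral.abs_integral_le_integral_abs (by linarith)).trans ?_
      refine le_trans ?_ (mul_le_mul_of_nonneg_left (integral_jacksonKernel_mul_abs_sin_le hN2)
        (by positivity))
      rw [← intervalIntegral.integral_const_mul]
      refine intervalIntegral.integral_mono_on (by linarith)
        ((by fun_prop : Continuous _).intervalIntegrable _ _)
        ((by fun_prop : Continuous _).intervalIntegrable _ _) fun t _ => ?_
      rw [abs_mul, abs_of_nonneg (jacksonKernel_nonneg N t)]
      refine (mul_le_mul_of_nonneg_left (abs_cosLift_secondDiff_le hf θ t)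
        (jacksonKernel_nonneg N t)).trans (le_of_eq ?_)
      ring
    rw [abs_mul, abs_of_pos hMpos, abs_sub_comm] at hle
    have hle' : |cosLift f θ - (Q.eval ((1 - Real.cos θ) / 2) - Q.eval 0)| ≤
        4 * |Real.sin (θ / 2)| * (Real.pi / (2 * N)) := by
      refine le_of_mul_le_mul_left (hle.trans (le_of_eq ?_)) hMpos
      ring
    refine hle'.trans ?_
    have hNK : (K : ℝ) ≤ N := by exact_mod_cast Nat.le_succ K
    have hs := abs_nonneg (Real.sin (θ / 2))
    -- The constant 7 is 4 · π/2 = 2π rounded up.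
    have : Real.pi / (2 * N) ≤ 7 / 4 / K := by
      rw [div_le_div_iff₀ (by positivity) hK0]
      nlinarith [Real.pi_lt_d2]
    calc 4 * |Real.sin (θ / 2)| * (Real.pi / (2 * N))
        ≤ 4 * |Real.sin (θ / 2)| * (7 / 4 / K) := by gcongr
      _ = 7 * |Real.sin (θ / 2)| / K := by ring
  refine ⟨Q - C (Q.eval 0), ?_, ?_, fun k => ?_, fun x hx => ?_⟩
  · rwa [natDegree_sub_C]
  · simp [coeff_zero_eq_eval_zero]
  · rw [coeff_sub, coeff_C]
    split_ifs with hk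
    · rw [hk, coeff_zero_eq_eval_zero, sub_self, abs_zero]
      positivity
    · rw [sub_zero]
      exact hQcoeff k
  · have hcos : Real.cos (Real.arccos (1 - 2 * x)) = 1 - 2 * x :=
      Real.cos_arccos (by linarith [hx.2]) (by linarith [hx.1])
    have hx' : (1 - Real.cos (Real.arccos (1 - 2 * x))) / 2 = x := by rw [hcos]; ring
    have hsin : |Real.sin (Real.arccos (1 - 2 * x) / 2)| = √x := by
      rw [← Real.sqrt_sq_eq_abs, Real.sin_sq_eq_half_sub, mul_div_cancel₀ _ two_ne_zero, hcos]
      congr 1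
      ring
    have h := herr (Real.arccos (1 - 2 * x))
    rw [hsin, cosLift, hx'] at h
    simpa using h

/-- The approximation theorem `exists_polynomial_approx` scaled to the interval `[0, B]`. -/
theorem exists_coeff_approx {f : ℝ → ℝ} (hf : LipschitzWith 1 f) (h0 : f 0 = 0) {K : ℕ}
    (hK : 1 ≤ K) {B : ℝ} (hB : 0 < B) :
    ∃ c : ℕ → ℝ, (∀ k, |c k| ≤ 16 ^ K * B * B ^ (-(k : ℤ))) ∧
      ∀ x ∈ Set.Icc (0 : ℝ) B,
        |f x - ∑ k ∈ Finset.Icc 1 K, c k * x ^ k| ≤ 7 * √(B * x) / K := by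
  have hg : LipschitzWith 1 fun y => B⁻¹ * f (B * y) := by
    refine LipschitzWith.of_dist_le_mul fun y z => ?_
    have h := hf.dist_le_mul (B * y) (B * z)
    rw [Real.dist_eq, Real.dist_eq, NNReal.coe_one, one_mul] at *
    rw [← mul_sub, abs_mul, abs_of_pos hB] at h
    rw [← mul_sub, abs_mul, abs_of_pos (inv_pos.2 hB), inv_mul_le_iff₀ hB]
    exact h
  obtain ⟨P, hdeg, hP0, hcoeff, happrox⟩ := exists_polynomial_approx hg (by simp [h0]) hK
  refine ⟨fun k => B * P.coeff k * B ^ (-(k : ℤ)), fun k => ?_, fun x hx => ?_⟩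
  · rw [abs_mul, abs_mul, abs_of_pos hB, abs_of_pos (zpow_pos hB _), mul_comm B]
    have := hcoeff k
    gcongr
  · have hy : x / B ∈ Set.Icc (0 : ℝ) 1 := ⟨div_nonneg hx.1 hB.le, (div_le_one hB).2 hx.2⟩
    have h := happrox _ hy
    have hxB : B * (x / B) = x := by field_simp
    simp only [hxB] at h
    have heval : P.eval (x / B) = ∑ k ∈ Finset.Icc 1 K, P.coeff k * (x / B) ^ k := by
      rw [Polynomial.eval_eq_sum_range' (Nat.lt_succ_of_le hdeg), Finset.sum_range_succ', hP0,
        zero_mul, add_zero, Finset.range_eq_Ico,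
        Finset.sum_Ico_add' (fun k => P.coeff k * (x / B) ^ k)]
      rfl
    have hsum : ∑ k ∈ Finset.Icc 1 K, B * P.coeff k * B ^ (-(k : ℤ)) * x ^ k =
        B * P.eval (x / B) := by
      rw [heval, Finset.mul_sum]
      refine Finset.sum_congr rfl fun k _ => ?_
      rw [zpow_neg, zpow_natCast, div_pow]
      ring
    have hsqrt : B * √(x / B) = √(B * x) := by
      rw [← Real.sqrt_sq hB.le, ← Real.sqrt_mul (sq_nonneg B), Real.sqrt_sq hB.le]
      congr 1
      field_simp
    rw [hsum]
    calc |f x - B * P.eval (x / B)| = |B * (B⁻¹ * f x - P.eval (x / B))| := by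
          congr 1; field_simp
      _ = B * |B⁻¹ * f x - P.eval (x / B)| := by rw [abs_mul, abs_of_pos hB]
      _ ≤ B * (7 * √(x / B) / K) := by gcongr
      _ = 7 * √(B * x) / K := by rw [← hsqrt]; ring

/-! ### Kantorovich potential and quantile functions -/

/-- Integrate the sign of G - F from 0; the value -1 chosen on ties is immaterial. For distribution
functions F and G this is an optimal dual potential. -/
theorem exists_lipschitz_dual {F G : ℝ → ℝ} (hF : Measurable F) (hG : Measurable G) :
    ∃ f : ℝ → ℝ, LipschitzWith 1 f ∧ f 0 = 0 ∧
      (∀ a b, a ≤ b → (∀ x ∈ Set.Ioo a b, F x < G x) → f b - f a = b - a) ∧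
      ∀ a b, a ≤ b → (∀ x ∈ Set.Ioo a b, G x < F x) → f a - f b = b - a := by
  set s : ℝ → ℝ := fun x => if F x < G x then 1 else -1 with hs
  have hsm : Measurable s :=
    Measurable.ite (measurableSet_lt hF hG) measurable_const measurable_const
  have hsb : ∀ x, ‖s x‖ ≤ 1 := by
    intro x
    simp only [hs]
    split_ifs <;> simp
  have hsi : ∀ a b, IntervalIntegrable s volume a b := fun a b =>
    (intervalIntegrable_const (c := (1 : ℝ))).mono_fun hsm.aestronglyMeasurable
      (Filter.Eventually.of_forall fun x => by simpa using hsb x)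
  have hsub : ∀ a b, (∫ x in (0 : ℝ)..b, s x) - ∫ x in (0 : ℝ)..a, s x = ∫ x in a..b, s x :=
    fun a b => intervalIntegral.integral_interval_sub_left (hsi _ _) (hsi _ _)
  have hconst : ∀ a b c, a ≤ b → (∀ x ∈ Set.Ioo a b, s x = c) →
      ∫ x in a..b, s x = (b - a) * c := by
    intro a b c hab h
    rw [intervalIntegral.integral_of_le hab, integral_Ioc_eq_integral_Ioo,
      setIntegral_congr_fun measurableSet_Ioo h]
    simp [hab]
  refine ⟨fun b => ∫ x in (0 : ℝ)..b, s x, ?_, by simp, fun a b hab h => ?_, fun a b hab h => ?_⟩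
  · refine LipschitzWith.of_dist_le_mul fun a b => ?_
    rw [Real.dist_eq, Real.dist_eq, hsub, ← Real.norm_eq_abs]
    exact intervalIntegral.norm_integral_le_of_norm_le_const fun x _ => hsb x
  · simp only
    rw [hsub, hconst a b 1 hab fun x hx => if_pos (h x hx), mul_one]
  · simp only
    rw [← neg_sub, hsub, hconst a b (-1) hab fun x hx => if_neg (h x hx).not_gt]
    ring

/-- Right-continuity of the distribution function makes the infimum attained, which gives the
nontrivial direction. -/
theorem quantile_le_iff {μ : Measure ℝ} [IsFiniteMeasure μ] {t : ℝ}
    (hne : {x : ℝ | t ≤ μ.real (Set.Iic x)}.Nonempty)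
    (hbdd : BddBelow {x : ℝ | t ≤ μ.real (Set.Iic x)}) (x : ℝ) :
    quantile μ t ≤ x ↔ t ≤ μ.real (Set.Iic x) := by
  refine ⟨fun h => ?_, fun h => csInf_le hbdd h⟩
  have hinter : ⋂ r > x, Set.Iic r = Set.Iic x := by
    ext y
    simp only [Set.mem_iInter, Set.mem_Iic]
    exact ⟨le_of_forall_gt_imp_ge_of_dense, fun h r hr => h.trans hr.le⟩
  have hlim : Filter.Tendsto (μ.real ∘ Set.Iic) (nhdsWithin x (Set.Ioi x))
      (nhds (μ.real (Set.Iic x))) := by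
    have h := tendsto_measure_biInter_gt (μ := μ) (s := Set.Iic) (a := x)
      (fun r _ => measurableSet_Iic.nullMeasurableSet) (fun i j _ hij => Set.Iic_subset_Iic.2 hij)
      ⟨x + 1, by linarith, measure_ne_top _ _⟩
    rw [hinter] at h
    exact (ENNReal.tendsto_toReal (measure_ne_top _ _)).comp h
  refine ge_of_tendsto hlim (Filter.eventually_of_mem self_mem_nhdsWithin fun r hr => ?_)
  obtain ⟨y, hy, hyr⟩ := exists_lt_of_csInf_lt hne (h.trans_lt hr)
  exact hy.trans (measureReal_mono (Set.Iic_subset_Iic.2 hyr.le))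

namespace IsLPSolution

variable {d K : ℕ} {B : ℝ} {p V : ℕ → ℝ} {μ : Measure ℝ}

theorem measure_univ (h : IsLPSolution d B K p V μ) : μ Set.univ = d := by
  rw [← measure_add_measure_compl (measurableSet_Icc (a := (0 : ℝ)) (b := B)), h.mass,
    h.supported, add_zero]

theorem isFiniteMeasure (h : IsLPSolution d B K p V μ) : IsFiniteMeasure μ :=
  ⟨by rw [h.measure_univ]; exact ENNReal.natCast_lt_top d⟩

theorem real_univ (h : IsLPSolution d B K p V μ) : μ.real Set.univ = d := by
  simp [Measure.real, h.measure_univ]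

theorem ae_mem (h : IsLPSolution d B K p V μ) : ∀ᵐ x ∂μ, x ∈ Set.Icc 0 B := h.supported

theorem restrict_eq (h : IsLPSolution d B K p V μ) : μ.restrict (Set.Icc 0 B) = μ :=
  Measure.restrict_eq_self_of_ae_mem h.ae_mem

theorem real_Iic_of_neg (h : IsLPSolution d B K p V μ) {x : ℝ} (hx : x < 0) :
    μ.real (Set.Iic x) = 0 := by
  have hsub : Set.Iic x ⊆ (Set.Icc 0 B)ᶜ := fun y hy hy' => absurd (hy'.1.trans hy) hx.not_ge
  have : μ (Set.Iic x) = 0 := measure_mono_null hsub h.supported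
  simp [Measure.real, this]

theorem real_Iic_self (h : IsLPSolution d B K p V μ) : μ.real (Set.Iic B) = d := by
  have := h.isFiniteMeasure
  refine le_antisymm ((measureReal_mono (Set.subset_univ _)).trans h.real_univ.le) ?_
  have h' : μ.real (Set.Icc 0 B) = d := by simp [Measure.real, h.mass]
  rw [← h']
  exact measureReal_mono Set.Icc_subset_Iic_self

theorem quantile_le_iff (h : IsLPSolution d B K p V μ) {t : ℝ} (ht : t ∈ Set.Ioc (0 : ℝ) d)
    (x : ℝ) : quantile μ t ≤ x ↔ t ≤ μ.real (Set.Iic x) := by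
  have := h.isFiniteMeasure
  refine LocalMomentMatching.quantile_le_iff ⟨B, ?_⟩ ⟨0, fun y hy => ?_⟩ x
  · rw [Set.mem_ofPred_eq, h.real_Iic_self]
    exact ht.2
  · by_contra! hlt
    have hy' : t ≤ μ.real (Set.Iic y) := hy
    rw [h.real_Iic_of_neg hlt] at hy'
    exact absurd ht.1 hy'.not_gt

theorem quantile_zero (μ : Measure ℝ) : quantile μ 0 = 0 := by
  -- At level 0 the set is all of ℝ, and its `sInf` is the default value 0, matching the convention
  -- Q(0) = 0.
  simp [quantile, measureReal_nonneg]

theorem quantile_mem (h : IsLPSolution d B K p V μ) (hB : 0 ≤ B) {t : ℝ}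
    (ht : t ∈ Set.Icc (0 : ℝ) d) : quantile μ t ∈ Set.Icc 0 B := by
  rcases ht.1.eq_or_lt with h0 | h0
  · rw [← h0, quantile_zero]
    exact ⟨le_rfl, hB⟩
  · constructor
    · by_contra! hlt
      have := (h.quantile_le_iff ⟨h0, ht.2⟩ (quantile μ t)).1 le_rfl
      rw [h.real_Iic_of_neg hlt] at this
      linarith
    · rw [h.quantile_le_iff ⟨h0, ht.2⟩, h.real_Iic_self]
      exact ht.2

theorem monotoneOn_quantile (h : IsLPSolution d B K p V μ) (hB : 0 ≤ B) :
    MonotoneOn (quantile μ) (Set.Icc 0 d) := by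
  intro s hs t ht hst
  rcases hs.1.eq_or_lt with h0 | h0
  · rw [← h0, quantile_zero]
    exact (h.quantile_mem hB ht).1
  · rw [h.quantile_le_iff ⟨h0, hs.2⟩]
    exact hst.trans ((h.quantile_le_iff ⟨h0.trans_le hst, ht.2⟩ _).1 le_rfl)

theorem aemeasurable_quantile (h : IsLPSolution d B K p V μ) (hB : 0 ≤ B) :
    AEMeasurable (quantile μ) (volume.restrict (Set.Ioc 0 (d : ℝ))) :=
  aemeasurable_restrict_of_monotoneOn measurableSet_Ioc
    ((h.monotoneOn_quantile hB).mono Set.Ioc_subset_Icc_self)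

/-- Inverse transform sampling: the levels with quantile at most x form the interval (0, μ(-∞, x]].
-/
theorem map_quantile (h : IsLPSolution d B K p V μ) (hB : 0 ≤ B) :
    (volume.restrict (Set.Ioc 0 (d : ℝ))).map (quantile μ) = μ := by
  have := h.isFiniteMeasure
  have hm := h.aemeasurable_quantile hB
  refine Measure.ext_of_Iic _ _ fun x => ?_
  rw [Measure.map_apply_of_aemeasurable hm measurableSet_Iic,
    Measure.restrict_apply' measurableSet_Ioc]
  have hset : quantile μ ⁻¹' Set.Iic x ∩ Set.Ioc 0 (d : ℝ) = Set.Ioc 0 (μ.real (Set.Iic x)) := by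
    ext t
    simp only [Set.mem_inter_iff, Set.mem_preimage, Set.mem_Iic]
    constructor
    · rintro ⟨h1, h2⟩
      exact ⟨h2.1, (h.quantile_le_iff h2 x).1 h1⟩
    · rintro ⟨h1, h2⟩
      have h3 : t ∈ Set.Ioc (0 : ℝ) d :=
        ⟨h1, h2.trans ((measureReal_mono (Set.subset_univ _)).trans h.real_univ.le)⟩
      exact ⟨(h.quantile_le_iff h3 x).2 h2, h3⟩
  rw [hset, Real.volume_Ioc, sub_zero, ofReal_measureReal]

theorem integrable (h : IsLPSolution d B K p V μ) {f : ℝ → ℝ} (hf : Continuous f) :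
    Integrable f μ := by
  have := h.isFiniteMeasure
  have : IntegrableOn f (Set.Icc 0 B) μ := hf.continuousOn.integrableOn_compact isCompact_Icc
  rwa [IntegrableOn, h.restrict_eq] at this

theorem intervalIntegrable_comp_quantile (h : IsLPSolution d B K p V μ) (hB : 0 ≤ B)
    {f : ℝ → ℝ} (hf : Continuous f) :
    IntervalIntegrable (fun t => f (quantile μ t)) volume 0 d := by
  rw [intervalIntegrable_iff_integrableOn_Ioc_of_le (Nat.cast_nonneg d)]
  have hi := h.integrable hf
  rw [← h.map_quantile hB] at hi
  exact (integrable_map_measure hf.aestronglyMeasurable (h.aemeasurable_quantile hB)).1 hi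

theorem integral_comp_quantile (h : IsLPSolution d B K p V μ) (hB : 0 ≤ B)
    {f : ℝ → ℝ} (hf : Continuous f) :
    ∫ t in (0 : ℝ)..d, f (quantile μ t) = ∫ x, f x ∂μ := by
  conv_rhs => rw [← h.map_quantile hB]
  rw [intervalIntegral.integral_of_le (Nat.cast_nonneg d),
    integral_map (h.aemeasurable_quantile hB) hf.aestronglyMeasurable]

/-- Cauchy-Schwarz, obtained by expanding the nonnegative variance of √x about its mean I/d. -/
theorem integral_sqrt_le (h : IsLPSolution d B K p V μ) :
    ∫ x, √x ∂μ ≤ √(d * ∫ x, x ∂μ) := by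
  have := h.isFiniteMeasure
  have hi1 := h.integrable Real.continuous_sqrt
  have hi2 : Integrable (fun x => x) μ := h.integrable continuous_id
  rcases d.eq_zero_or_pos with hd | hd
  · have hμ : μ = 0 := by
      rw [← Measure.measure_univ_eq_zero, h.measure_univ, hd, Nat.cast_zero]
    simp [hμ]
  have hd' : (0 : ℝ) < d := by exact_mod_cast hd
  set I := ∫ x, √x ∂μ with hI
  refine Real.le_sqrt_of_sq_le ?_
  have h0 : 0 ≤ ∫ x, (√x - I / d) ^ 2 ∂μ := integral_nonneg fun x => sq_nonneg _
  have h1 : ∫ x, (√x - I / d) ^ 2 ∂μ = ∫ x, (x - 2 * (I / d) * √x + (I / d) ^ 2) ∂μ := by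
    refine integral_congr_ae (h.ae_mem.mono fun x hx => ?_)
    simp only
    rw [sub_sq, Real.sq_sqrt hx.1]
    ring
  have h2 : ∫ x, (x - 2 * (I / d) * √x + (I / d) ^ 2) ∂μ =
      ∫ x, x ∂μ - 2 * (I / d) * I + (I / d) ^ 2 * d := by
    rw [integral_add (h.integrable (by fun_prop)) (integrable_const _),
      integral_sub hi2 (hi1.const_mul _), integral_const_mul, integral_const, h.real_univ,
      smul_eq_mul, mul_comm (d : ℝ)]
  rw [h1, h2] at h0
  have h3 : ∫ x, x ∂μ - 2 * (I / d) * I + (I / d) ^ 2 * d = ∫ x, x ∂μ - I ^ 2 / d := by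
    field_simp
    ring
  rw [h3, sub_nonneg, div_le_iff₀ hd'] at h0
  linarith

theorem abs_integral_sub_le (h : IsLPSolution d B K p V μ) (hB : 0 < B) {f : ℝ → ℝ}
    (hf : Continuous f) {c : ℕ → ℝ}
    (hc : ∀ x ∈ Set.Icc (0 : ℝ) B,
      |f x - ∑ k ∈ Finset.Icc 1 K, c k * x ^ k| ≤ 7 * √(B * x) / K) :
    |∫ x, f x ∂μ - ∑ k ∈ Finset.Icc 1 K, c k * ∫ x, x ^ k ∂μ| ≤
      7 * √(B * d * ∫ x, x ∂μ) / K := by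
  have hpoly : ∑ k ∈ Finset.Icc 1 K, c k * ∫ x, x ^ k ∂μ =
      ∫ x, ∑ k ∈ Finset.Icc 1 K, c k * x ^ k ∂μ := by
    rw [integral_finsetSum _ fun k _ => h.integrable (by fun_prop)]
    simp only [integral_const_mul]
  rw [hpoly, ← integral_sub (h.integrable hf) (h.integrable (by fun_prop))]
  refine abs_integral_le_integral_abs.trans ?_
  calc ∫ x, |f x - ∑ k ∈ Finset.Icc 1 K, c k * x ^ k| ∂μ
      ≤ ∫ x, 7 * √B / K * √x ∂μ := by
        refine integral_mono_ae (h.integrable (by fun_prop)) (h.integrable (by fun_prop))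
          (h.ae_mem.mono fun x hx => (hc x hx).trans (le_of_eq ?_))
        rw [Real.sqrt_mul hB.le]
        ring
    _ = 7 * √B / K * ∫ x, √x ∂μ := integral_const_mul _ _
    _ ≤ 7 * √B / K * √(d * ∫ x, x ∂μ) := by
        gcongr
        exact h.integral_sqrt_le
    _ = 7 * √(B * d * ∫ x, x ∂μ) / K := by
        rw [mul_assoc B, Real.sqrt_mul hB.le]
        ring

end IsLPSolution

/-! ### The empirical measure of α: feasibility and distribution function -/

/-- The counting measure of the entries of a vector. -/
noncomputable def empiricalMeasure {d : ℕ} (α : Fin d → ℝ) : Measure ℝ :=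
  ∑ i, Measure.dirac (α i)

theorem integral_empiricalMeasure {d : ℕ} (α : Fin d → ℝ) (f : ℝ → ℝ) :
    ∫ x, f x ∂(empiricalMeasure α) = ∑ i, f (α i) := by
  rw [empiricalMeasure, integral_finsetSum_measure fun i _ => integrable_dirac (by simp)]
  simp

/-- Beyond feasibility of the program, this lets every estimate for solutions apply to α itself. -/
theorem isLPSolution_empiricalMeasure {d K : ℕ} {B : ℝ} {p V : ℕ → ℝ} {α : Fin d → ℝ}
    (h0 : ∀ i, 0 ≤ α i) (hB : ∀ i, α i ≤ B)
    (hp : ∀ k ∈ Finset.Icc 1 K, |p k - powerSum k α| ≤ V k) :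
    IsLPSolution d B K p V (empiricalMeasure α) := by
  have hsupp : empiricalMeasure α (Set.Icc 0 B)ᶜ = 0 := by
    simp [empiricalMeasure, h0, hB]
  have hmem : ∀ᵐ x ∂(empiricalMeasure α), x ∈ Set.Icc 0 B := hsupp
  refine ⟨hsupp, by simp [empiricalMeasure, h0, hB], fun k hk => ?_⟩
  rw [Measure.restrict_eq_self_of_ae_mem hmem, integral_empiricalMeasure]
  exact hp k hk

theorem level_mem_Icc {d : ℕ} (i : Fin d) {v : ℝ} (hv : v ∈ Set.Icc (0 : ℝ) 1) :
    (d : ℝ) - 1 - i + v ∈ Set.Icc (0 : ℝ) d := by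
  have h1 : ((i : ℕ) : ℝ) + 1 ≤ d := by exact_mod_cast i.isLt
  have h2 : (0 : ℝ) ≤ (i : ℕ) := Nat.cast_nonneg _
  exact ⟨by linarith [hv.1], by linarith [hv.2]⟩

/-- With `card_le_of_lt`, this says that the counting function of α jumps at α_i across the whole
block of levels from d-1-i to d-i. -/
theorem le_card_of_lt {d : ℕ} {α : Fin d → ℝ} (hα : Antitone α) (i : Fin d) {x : ℝ}
    (hx : α i < x) :
    (d : ℝ) - i ≤ ((Finset.univ.filter fun j => α j ≤ x).card : ℝ) := by
  have h : Finset.Ici i ⊆ Finset.univ.filter fun j => α j ≤ x := fun j hj => by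
    simpa using (hα (Finset.mem_Ici.1 hj)).trans hx.le
  have hc := Finset.card_le_card h
  rw [Fin.card_Ici] at hc
  have : (d : ℝ) ≤ ((Finset.univ.filter fun j => α j ≤ x).card : ℝ) + (i : ℕ) := by
    exact_mod_cast (by omega : d ≤ (Finset.univ.filter fun j => α j ≤ x).card + (i : ℕ))
  linarith

theorem card_le_of_lt {d : ℕ} {α : Fin d → ℝ} (hα : Antitone α) (i : Fin d) {x : ℝ}
    (hx : x < α i) :
    ((Finset.univ.filter fun j => α j ≤ x).card : ℝ) ≤ (d : ℝ) - 1 - i := by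
  have h : (Finset.univ.filter fun j => α j ≤ x) ⊆ Finset.Ioi i := fun j hj => by
    rw [Finset.mem_Ioi]
    by_contra! hji
    have h1 : α j ≤ x := by simpa using hj
    exact absurd ((hα hji).trans h1) hx.not_ge
  have hc := Finset.card_le_card h
  rw [Fin.card_Ioi] at hc
  have hi := i.isLt
  have : ((Finset.univ.filter fun j => α j ≤ x).card : ℝ) + 1 + (i : ℕ) ≤ d := by
    exact_mod_cast
      (by omega : (Finset.univ.filter fun j => α j ≤ x).card + 1 + (i : ℕ) ≤ d)
  linarith

theorem integral_unitInterval (g : ℝ → ℝ) :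
    ∫ v : unitInterval, g v = ∫ v in (0 : ℝ)..1, g v := by
  rw [intervalIntegral.integral_of_le zero_le_one, ← integral_Icc_eq_integral_Ioc]
  exact integral_subtype_comap measurableSet_Icc g

/-! ### The randomized rounding and its expected error -/

namespace IsLPSolution

variable {d K : ℕ} {B : ℝ} {p V : ℕ → ℝ} {μ : Measure ℝ}

theorem round_mem (h : IsLPSolution d B K p V μ) (hB : 0 ≤ B) (u : Fin d → unitInterval)
    (i : Fin d) : round d μ u i ∈ Set.Icc 0 B :=
  h.quantile_mem hB (level_mem_Icc i (u i).2)

theorem measurable_quantile_level (h : IsLPSolution d B K p V μ) (hB : 0 ≤ B) (i : Fin d) :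
    Measurable fun v : unitInterval => quantile μ ((d : ℝ) - 1 - i + v) := by
  refine Monotone.measurable fun v w hvw => ?_
  refine h.monotoneOn_quantile hB (level_mem_Icc i v.2) (level_mem_Icc i w.2) ?_
  have : (v : ℝ) ≤ w := hvw
  linarith

theorem measurable_round (h : IsLPSolution d B K p V μ) (hB : 0 ≤ B) :
    Measurable (round d μ) :=
  measurable_pi_lambda _ fun i => (h.measurable_quantile_level hB i).comp (measurable_pi_apply i)

theorem antitone_round (h : IsLPSolution d B K p V μ) (hB : 0 ≤ B) (u : Fin d → unitInterval) :
    Antitone (round d μ u) := by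
  intro i j hij
  rcases hij.eq_or_lt with rfl | hlt
  · exact le_rfl
  · refine h.monotoneOn_quantile hB (level_mem_Icc j (u j).2) (level_mem_Icc i (u i).2) ?_
    have h1 : ((i : ℕ) : ℝ) + 1 ≤ (j : ℕ) := by exact_mod_cast hlt
    linarith [(u i).2.1, (u j).2.2]

theorem integrable_abs_round_sub (h : IsLPSolution d B K p V μ) (hB : 0 ≤ B) (α : Fin d → ℝ)
    (i : Fin d) :
    Integrable (fun u : Fin d → unitInterval => |round d μ u i - α i|) volume := by
  have hm : Measurable fun u : Fin d → unitInterval => |round d μ u i - α i| := by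
    have := (measurable_pi_apply i).comp (h.measurable_round hB)
    exact (this.sub_const _).abs
  refine Integrable.of_bound hm.aestronglyMeasurable (B + |α i|)
    (Filter.Eventually.of_forall fun u => ?_)
  have h1 := h.round_mem hB u i
  rw [Real.norm_eq_abs, abs_abs]
  refine (abs_sub _ _).trans (add_le_add_left ?_ _)
  rw [abs_of_nonneg h1.1]
  exact h1.2

theorem integrable_dTV (h : IsLPSolution d B K p V μ) (hB : 0 ≤ B) (α : Fin d → ℝ) :
    Integrable (fun u : Fin d → unitInterval => dTV (round d μ u) α) volume :=
  (integrable_finsetSum _ fun i _ => h.integrable_abs_round_sub hB α i).const_mul _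

/-- The d blocks of levels tile [0, d]; since block i is counted from the right, the sum is
reflected before concatenation. -/
theorem sum_integral_comp_quantile (h : IsLPSolution d B K p V μ) (hB : 0 ≤ B) {f : ℝ → ℝ}
    (hf : Continuous f) :
    ∑ i : Fin d, ∫ v in (0 : ℝ)..1, f (quantile μ ((d : ℝ) - 1 - i + v)) = ∫ x, f x ∂μ := by
  have hsub : ∀ k < d, IntervalIntegrable (fun t => f (quantile μ t)) volume
      ((k : ℕ) : ℝ) ((k + 1 : ℕ) : ℝ) := by
    intro k hk
    refine (h.intervalIntegrable_comp_quantile hB hf).mono_set ?_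
    have hk' : ((k + 1 : ℕ) : ℝ) ≤ d := by exact_mod_cast hk
    rw [Set.uIcc_of_le (by simp), Set.uIcc_of_le (Nat.cast_nonneg d)]
    exact Set.Icc_subset_Icc (Nat.cast_nonneg k) hk'
  rw [← h.integral_comp_quantile hB hf]
  have hadj := intervalIntegral.sum_integral_adjacent_intervals
    (f := fun t => f (quantile μ t)) (μ := volume) (a := fun k : ℕ => (k : ℝ)) (n := d) hsub
  simp only [Nat.cast_zero] at hadj
  rw [← hadj, ← Finset.sum_range_reflect, ← Fin.sum_univ_eq_sum_range
    (fun j => ∫ t in ((d - 1 - j : ℕ) : ℝ)..((d - 1 - j + 1 : ℕ) : ℝ), f (quantile μ t))]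
  refine Finset.sum_congr rfl fun i _ => ?_
  have hi : ((d - 1 - (i : ℕ) : ℕ) : ℝ) = (d : ℝ) - 1 - (i : ℕ) := by
    have := i.isLt
    rw [Nat.cast_sub (by omega), Nat.cast_sub (by omega), Nat.cast_one]
  rw [intervalIntegral.integral_comp_add_left (fun t => f (quantile μ t)), Nat.cast_add, hi,
    add_zero, Nat.cast_one]

/-- Kantorovich duality for the rounding error. -/
theorem exists_integral_dTV_eq (h : IsLPSolution d B K p V μ) (hB : 0 ≤ B) {α : Fin d → ℝ}
    (hα : Antitone α) :
    ∃ f : ℝ → ℝ, LipschitzWith 1 f ∧ f 0 = 0 ∧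
      ∫ u : Fin d → unitInterval, dTV (round d μ u) α =
        1 / 2 * (∫ x, f x ∂μ - ∑ i, f (α i)) := by
  have := h.isFiniteMeasure
  have hFmono : Monotone fun x => μ.real (Set.Iic x) :=
    fun x y hxy => measureReal_mono (Set.Iic_subset_Iic.2 hxy)
  have hGmono : Monotone fun x => ((Finset.univ.filter fun j => α j ≤ x).card : ℝ) := by
    intro x y hxy
    exact Nat.cast_le.2 (Finset.card_le_card
      (Finset.monotone_filter_right _ fun j _ (hj : α j ≤ x) => hj.trans hxy))
  obtain ⟨f, hf, h0, hlt, hgt⟩ := exists_lipschitz_dual hFmono.measurable hGmono.measurable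
  have hfc := hf.continuous
  refine ⟨f, hf, h0, ?_⟩
  -- Between α_i and the quantile at level t the two distribution functions lie on opposite sides of
  -- t, so f has constant slope ±1 there. Excluding v = 0 keeps t > d-1-i, which makes the
  -- comparison strict and t positive.
  have hpt : ∀ i : Fin d, ∀ v ∈ Set.Ioc (0 : ℝ) 1,
      |quantile μ ((d : ℝ) - 1 - i + v) - α i| =
        f (quantile μ ((d : ℝ) - 1 - i + v)) - f (α i) := by
    intro i v hv
    set t := (d : ℝ) - 1 - i + v with ht
    have htd := level_mem_Icc i (Set.Ioc_subset_Icc_self hv)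
    have hi : ((i : ℕ) : ℝ) + 1 ≤ d := by exact_mod_cast i.isLt
    have ht' : t ∈ Set.Ioc (0 : ℝ) d := ⟨by linarith [hv.1], htd.2⟩
    rcases le_total (α i) (quantile μ t) with hle | hle
    · rw [abs_of_nonneg (sub_nonneg.2 hle), hlt _ _ hle fun x hx => ?_]
      have h1 : μ.real (Set.Iic x) < t := by
        by_contra! hx'
        exact absurd ((h.quantile_le_iff ht' x).2 hx') hx.2.not_ge
      have h2 := le_card_of_lt hα i hx.1
      linarith [hv.2]
    · rw [abs_of_nonpos (sub_nonpos.2 hle), neg_sub, hgt _ _ hle fun x hx => ?_]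
      have h1 := (h.quantile_le_iff ht' x).1 hx.1.le
      have h2 := card_le_of_lt hα i hx.2
      linarith [hv.1]
  have hcoord : ∀ i : Fin d, ∫ u : Fin d → unitInterval, |round d μ u i - α i| =
      (∫ v in (0 : ℝ)..1, f (quantile μ ((d : ℝ) - 1 - i + v))) - f (α i) := by
    intro i
    have hm := h.measurable_quantile_level hB i
    -- Each summand depends on one seed coordinate only, so just its marginal law enters.
    have h1 : ∫ u : Fin d → unitInterval, |round d μ u i - α i| =
        ∫ v : unitInterval, |quantile μ ((d : ℝ) - 1 - i + v) - α i| :=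
      integral_comp_eval (μ := fun _ : Fin d => (volume : Measure unitInterval))
        (f := fun v : unitInterval => |quantile μ ((d : ℝ) - 1 - i + v) - α i|)
        (hm.sub_const _).abs.aestronglyMeasurable
    have hint : IntervalIntegrable (fun v => f (quantile μ ((d : ℝ) - 1 - i + v))) volume 0 1 := by
      have hcont := (h.intervalIntegrable_comp_quantile hB hfc).comp_add_left ((d : ℝ) - 1 - i)
      refine hcont.mono_set ?_
      have hi : ((i : ℕ) : ℝ) + 1 ≤ d := by exact_mod_cast i.isLt
      have hi' : (0 : ℝ) ≤ (i : ℕ) := Nat.cast_nonneg _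
      rw [Set.uIcc_of_le zero_le_one, Set.uIcc_of_le (by linarith)]
      exact Set.Icc_subset_Icc (by linarith) (by linarith)
    rw [h1, integral_unitInterval fun v => |quantile μ ((d : ℝ) - 1 - i + v) - α i|,
      intervalIntegral.integral_of_le zero_le_one,
      setIntegral_congr_fun measurableSet_Ioc (hpt i),
      ← intervalIntegral.integral_of_le zero_le_one,
      intervalIntegral.integral_sub hint intervalIntegrable_const]
    simp
  unfold dTV
  rw [integral_const_mul, integral_finsetSum _ fun i _ => h.integrable_abs_round_sub hB α i,
    Finset.sum_congr rfl fun i _ => hcoord i, Finset.sum_sub_distrib,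
    h.sum_integral_comp_quantile hB hfc]

end IsLPSolution

/-! ### Assembling the bounds -/

theorem sixteen_pow_le_two_rpow (K : ℕ) : (16 : ℝ) ^ K ≤ (2 : ℝ) ^ (9 * (K : ℝ) / 2) := by
  have h : (16 : ℝ) ^ K = (2 : ℝ) ^ (4 * (K : ℝ)) := by
    rw [Real.rpow_mul zero_le_two, Real.rpow_natCast]
    norm_num
  rw [h]
  refine Real.rpow_le_rpow_of_exponent_le one_le_two ?_
  have : (0 : ℝ) ≤ K := Nat.cast_nonneg K
  linarith

/-- The crude first bound uses only |f(x)| ≤ x and serves when V_1 is large; the second combines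
duality, approximation and moment matching. -/
theorem integral_dTV_round_le {d K : ℕ} {B : ℝ} {p V : ℕ → ℝ} {α : Fin d → ℝ} (hK : 1 ≤ K)
    (hB : 0 < B) (hα : Antitone α) (h0 : ∀ i, 0 ≤ α i) (hαB : ∀ i, α i ≤ B)
    (hp : ∀ k ∈ Finset.Icc 1 K, |p k - powerSum k α| ≤ V k) {μ : Measure ℝ}
    (h : IsLPSolution d B K p V μ) :
    ∫ u : Fin d → unitInterval, dTV (round d μ u) α ≤ powerSum 1 α + V 1 ∧
    ∫ u : Fin d → unitInterval, dTV (round d μ u) α ≤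
      11 * √(B * d * (powerSum 1 α + V 1)) / K + (2 : ℝ) ^ (9 * (K : ℝ) / 2) * B *
        ∑ k ∈ Finset.Icc 1 K, B ^ (-(k : ℤ)) * V k := by
  obtain ⟨f, hf, hf0, heq⟩ := h.exists_integral_dTV_eq hB.le hα
  have hν := isLPSolution_empiricalMeasure h0 hαB hp
  have hmom : ∀ k ∈ Finset.Icc 1 K, |∫ x, x ^ k ∂μ - powerSum k α| ≤ 2 * V k := by
    intro k hk
    have h1 := h.moments k hk
    rw [h.restrict_eq, abs_le] at h1
    have h2 := hp k hk
    rw [abs_le] at h2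
    rw [abs_le]
    constructor <;> linarith [h1.1, h1.2, h2.1, h2.2]
  have h1K : 1 ∈ Finset.Icc 1 K := Finset.mem_Icc.2 ⟨le_rfl, hK⟩
  have hV1 : 0 ≤ V 1 := (abs_nonneg _).trans (hp 1 h1K)
  have hp1 : 0 ≤ powerSum 1 α := Finset.sum_nonneg fun i _ => pow_nonneg (h0 i) 1
  have hp1' : powerSum 1 α = ∑ i, α i := by simp [powerSum]
  have hm1 : ∫ x, x ∂μ ≤ 2 * (powerSum 1 α + V 1) := by
    have := (abs_le.1 (hmom 1 h1K)).2
    simp only [pow_one] at this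
    linarith
  have hfabs : ∀ x, 0 ≤ x → |f x| ≤ x := by
    intro x hx
    have := hf.dist_le_mul x 0
    rwa [Real.dist_eq, Real.dist_eq, hf0, sub_zero, sub_zero, NNReal.coe_one, one_mul,
      abs_of_nonneg hx] at this
  constructor
  · have hupper : ∫ x, f x ∂μ ≤ ∫ x, x ∂μ :=
      integral_mono_ae (h.integrable hf.continuous) (h.integrable continuous_id)
        (h.ae_mem.mono fun x hx => (le_abs_self _).trans (hfabs x hx.1))
    have hlower : -∑ i, f (α i) ≤ ∑ i, α i := by
      rw [← Finset.sum_neg_distrib]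
      exact Finset.sum_le_sum fun i _ => (neg_le_abs _).trans (hfabs _ (h0 i))
    have := (abs_le.1 (hmom 1 h1K)).2
    simp only [pow_one] at this
    rw [heq]
    linarith
  · obtain ⟨c, hc, happ⟩ := exists_coeff_approx hf hf0 hK hB
    have hK0 : (0 : ℝ) < K := by exact_mod_cast hK
    set W := √(B * d * (powerSum 1 α + V 1)) with hW
    have hBd : 0 ≤ B * d := by positivity
    have e1 := h.abs_integral_sub_le hB hf.continuous happ
    have e2 := hν.abs_integral_sub_le hB hf.continuous happ
    simp only [integral_empiricalMeasure] at e2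
    rw [← hp1'] at e2
    have s1 : √(B * d * ∫ x, x ∂μ) ≤ 2 * W := by
      rw [hW, show (2 : ℝ) = √4 by rw [show (4 : ℝ) = 2 ^ 2 by norm_num]; simp,
        ← Real.sqrt_mul (by norm_num)]
      refine Real.sqrt_le_sqrt ?_
      nlinarith [mul_le_mul_of_nonneg_left hm1 hBd, mul_nonneg hBd (add_nonneg hp1 hV1)]
    have s2 : √(B * d * powerSum 1 α) ≤ W :=
      Real.sqrt_le_sqrt (mul_le_mul_of_nonneg_left (by linarith) hBd)
    have e1' := (abs_le.1 e1).2
    have e2' := (abs_le.1 e2).1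
    have t1 : 7 * √(B * d * ∫ x, x ∂μ) / K ≤ 14 * (W / K) := by
      rw [mul_div_assoc]
      have : √(B * d * ∫ x, x ∂μ) / K ≤ 2 * W / K := by gcongr
      rw [mul_div_assoc] at this
      linarith
    have t2 : 7 * √(B * d * powerSum 1 α) / K ≤ 7 * (W / K) := by
      rw [mul_div_assoc]
      gcongr
    have hpoly : ∑ k ∈ Finset.Icc 1 K, c k * ∫ x, x ^ k ∂μ -
        ∑ k ∈ Finset.Icc 1 K, c k * ∑ i, α i ^ k ≤
        2 * ((2 : ℝ) ^ (9 * (K : ℝ) / 2) * B *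
          ∑ k ∈ Finset.Icc 1 K, B ^ (-(k : ℤ)) * V k) := by
      rw [← Finset.sum_sub_distrib, Finset.mul_sum, Finset.mul_sum]
      refine Finset.sum_le_sum fun k hk => ?_
      rw [← mul_sub]
      have hVk : 0 ≤ V k := (abs_nonneg _).trans (hp k hk)
      have hz : 0 < B ^ (-(k : ℤ)) := zpow_pos hB _
      calc c k * (∫ x, x ^ k ∂μ - ∑ i, α i ^ k)
          ≤ |c k| * |∫ x, x ^ k ∂μ - ∑ i, α i ^ k| := (le_abs_self _).trans (abs_mul _ _).le
        _ ≤ (16 ^ K * B * B ^ (-(k : ℤ))) * (2 * V k) :=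
            mul_le_mul (hc k) (hmom k hk) (abs_nonneg _) (by positivity)
        _ ≤ ((2 : ℝ) ^ (9 * (K : ℝ) / 2) * B * B ^ (-(k : ℤ))) * (2 * V k) := by
            gcongr
            exact sixteen_pow_le_two_rpow K
        _ = 2 * ((2 : ℝ) ^ (9 * (K : ℝ) / 2) * B * (B ^ (-(k : ℤ)) * V k)) := by ring
    have hWK : 0 ≤ W / K := div_nonneg (Real.sqrt_nonneg _) hK0.le
    -- The errors 14 from μ and 7 from α are halved by duality: 21/2 ≤ 11.
    rw [heq, mul_div_assoc]
    linarith

end LocalMomentMatching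

theorem theorem7p1 :
    ∃ C : ℝ, 0 < C ∧
      ∀ (d K : ℕ) (B : ℝ) (p V : ℕ → ℝ) (α : Fin d → ℝ),
        1 ≤ K → 0 < B →
        Antitone α → (∀ i, 0 ≤ α i) → (∀ i, α i ≤ B) → ∑ i, α i ≤ 1 →
        (∀ k ∈ Finset.Icc 1 K, |p k - LocalMomentMatching.powerSum k α| ≤ V k) →
        -- the linear program has a solution ...
        (∃ μ : Measure ℝ, LocalMomentMatching.IsLPSolution d B K p V μ) ∧
        -- ... and, whichever solution is found, rounding it gives a good sorted estimate
        ∀ μ : Measure ℝ, LocalMomentMatching.IsLPSolution d B K p V μ →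
          Measurable (LocalMomentMatching.round d μ) ∧
          (∀ u, Antitone (LocalMomentMatching.round d μ u)) ∧
          Integrable (fun u : Fin d → unitInterval =>
            LocalMomentMatching.dTV (LocalMomentMatching.round d μ u) α) volume ∧
          ∫ u : Fin d → unitInterval,
              LocalMomentMatching.dTV (LocalMomentMatching.round d μ u) α
            ≤ C * (√(B * d) / K +
                (2 : ℝ) ^ (9 * (K : ℝ) / 2) * B *
                  ∑ k ∈ Finset.Icc 1 K, B ^ (-(k : ℤ)) * V k) ∧
          ∫ u : Fin d → unitInterval,
              LocalMomentMatching.dTV (LocalMomentMatching.round d μ u) α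
            ≤ C * (√(B * d * (LocalMomentMatching.powerSum 1 α + V 1)) / K +
                (2 : ℝ) ^ (9 * (K : ℝ) / 2) * B *
                  ∑ k ∈ Finset.Icc 1 K, B ^ (-(k : ℤ)) * V k) := by
  -- 22 = 2 · 11, where 2 bounds √(p_1 + V_1) when V_1 ≤ 1.
  refine ⟨22, by norm_num, fun d K B p V α hK hB hα h0 hαB hsum hp =>
    ⟨⟨_, LocalMomentMatching.isLPSolution_empiricalMeasure h0 hαB hp⟩, fun μ h =>
      ⟨h.measurable_round hB.le, h.antitone_round hB.le, h.integrable_dTV hB.le α, ?_⟩⟩⟩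
  obtain ⟨hcrude, hfine⟩ :=
    LocalMomentMatching.integral_dTV_round_le hK hB hα h0 hαB hp h
  have hp1 : LocalMomentMatching.powerSum 1 α ≤ 1 := by
    simpa [LocalMomentMatching.powerSum] using hsum
  have hV : ∀ k ∈ Finset.Icc 1 K, 0 ≤ V k := fun k hk => (abs_nonneg _).trans (hp k hk)
  have h1K : 1 ∈ Finset.Icc 1 K := Finset.mem_Icc.2 ⟨le_rfl, hK⟩
  have hpow : (1 : ℝ) ≤ (2 : ℝ) ^ (9 * (K : ℝ) / 2) :=
    Real.one_le_rpow one_le_two (by positivity)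
  set R := (2 : ℝ) ^ (9 * (K : ℝ) / 2) * B * ∑ k ∈ Finset.Icc 1 K, B ^ (-(k : ℤ)) * V k with hR
  -- The term k = 1 of R alone is 2^(9K/2) V_1.
  have hRV : V 1 ≤ R := by
    have hle : B ^ (-((1 : ℕ) : ℤ)) * V 1 ≤ ∑ k ∈ Finset.Icc 1 K, B ^ (-(k : ℤ)) * V k :=
      Finset.single_le_sum (f := fun k : ℕ => B ^ (-(k : ℤ)) * V k)
        (fun k hk => mul_nonneg (zpow_pos hB _).le (hV k hk)) h1K
    calc V 1 = 1 * B * (B ^ (-((1 : ℕ) : ℤ)) * V 1) := by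
          rw [Nat.cast_one, zpow_neg_one]
          field_simp
      _ ≤ R := by
          rw [hR]
          have := hV 1 h1K
          gcongr
  have hR0 : 0 ≤ R := (hV 1 h1K).trans hRV
  have hK0 : (0 : ℝ) < K := by exact_mod_cast hK
  have hX : 0 ≤ √(B * d) / K := by positivity
  constructor
  -- If V_1 ≤ 1 then p_1 + V_1 ≤ 2 and the refined bound suffices; otherwise the crude bound is at
  -- most 2 V_1 ≤ 2R.
  · rcases le_total (V 1) 1 with hV1 | hV1
    · have hs : √(B * d * (LocalMomentMatching.powerSum 1 α + V 1)) ≤ 2 * √(B * d) := by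
        rw [Real.sqrt_mul (by positivity), mul_comm]
        refine mul_le_mul_of_nonneg_right ?_ (Real.sqrt_nonneg _)
        rw [Real.sqrt_le_left zero_le_two]
        linarith
      have : 11 * √(B * d * (LocalMomentMatching.powerSum 1 α + V 1)) / K ≤
          22 * (√(B * d) / K) := by
        rw [mul_div_assoc', div_le_div_iff_of_pos_right hK0]
        linarith
      linarith
    · linarith
  · have hY : 0 ≤ √(B * d * (LocalMomentMatching.powerSum 1 α + V 1)) / K := by positivity
    rw [mul_div_assoc] at hfine
    linarith
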